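/- A first-order theory $T$ has the Schröder–Bernstein (SB) property if any two models of $T$ that are elementarily embeddable into each other are isomorphic. For a prime $p$, let $\mathbb{Z}_{(p)}$ denote the localization of the ring $\mathbb{Z}$ at the prime ideal $(p)$, regarded as an additive group. Let $I$ be a nonempty (possibly infinite) index set, let $\langle p_i : i \in I\rangle$ be a family of pairwise distinct primes, and let $\langle k_i : i \in I\rangle$ be a family of positive integers. Then the complete first-order theory $$T = \mathrm{Th}\Bigl(\bigoplus_{i \in I} \mathbb{Z}_{(p_i)}^{k_i},\, +\Bigr)$$ in the pure language of groups $\{+\}$ does not have the SB property. -/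

import Mathlib

open scoped FirstOrder
open scoped DirectSum

universe u v w

namespace FirstOrder.Language

/-- A first-order theory `T` has the Schröder–Bernstein property if any two of its models that are
elementarily bi-embeddable are isomorphic (models with carriers in `Type w`). -/
def Theory.HasSBProperty {L : Language.{u, v}} (T : L.Theory) : Prop :=
  ∀ M N : Theory.ModelType.{u, v, w} T,
    Nonempty (M ↪ₑ[L] N) → Nonempty (N ↪ₑ[L] M) → Nonempty (M ≃[L] N)

end FirstOrder.Language

namespace AdditiveTheory

/-- The only function symbol of the pure language of groups: a binary symbol for addition. -/
inductive AddFunc : ℕ → Type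
  | add : AddFunc 2

/-- The pure language of groups `{+}`. -/
def addLanguage : FirstOrder.Language.{0, 0} where
  Functions := AddFunc
  Relations := fun _ => Empty

/-- The structure `(G, +)`. -/
abbrev addStructure (G : Type u) [Add G] : addLanguage.Structure G where
  funMap := fun {_} f x =>
    match f, x with
    | .add, x => x 0 + x 1
  RelMap := fun {_} r _ => r.elim

/-- `Th(G, +)`, the complete theory of `(G, +)` in the language `{+}`. -/
def Th (G : Type u) [Add G] : addLanguage.Theory :=
  letI := addStructure G
  addLanguage.completeTheory G

instance isPrime_span (p : Nat.Primes) : (Ideal.span {((p : ℕ) : ℤ)}).IsPrime :=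
  (Ideal.span_singleton_prime (Nat.cast_ne_zero.mpr p.2.ne_zero)).mpr
    (Nat.prime_iff_prime_int.mp p.2)

/-- `ℤ_(p)`, the localization of the ring `ℤ` at the prime ideal `(p)`. -/
abbrev ZLocal (p : Nat.Primes) : Type :=
  Localization.AtPrime (Ideal.span {((p : ℕ) : ℤ)})

end AdditiveTheory

/-! Call a homomorphism pure dense if it is injective with pure range meeting every coset of `n •
B`, `n ≠ 0`. From a nontrivial group to a torsion-free one such a map is elementary
(`IsPureDense.nonempty_elementaryEmbedding`): a formula only depends on congruences modulo some `m`
and on integer relations with coefficients bounded by some `r`, and both can be preserved when a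
tuple is extended.

Inside `ℤ_[p]`, the group `ℤ_(p)` is the set of points lying in `ℚ`. Take a unit `x` transcendental
over `ℚ` and replace a single summand `ℤ_(p)` by the `p`-adic integers in `V = ℚ[x]`, or by those in
`V' = {P(x) : P has no linear term}`. The original sum embeds purely and densely in both new sums,
so both are models. Since `V' ⊆ V` and `x² V ⊆ V'`, multiplications by `1` and `x²` embed the two
models into each other.

They are not isomorphic (`isEmpty_addEquiv_spaceAt`): an isomorphism acts on the modified summand as
multiplication by some `a ∈ V'` with inverse in `V`. Then `a` is a nonzero constant, but `x * a ∈
V'` is required. -/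

namespace AdditiveTheory

open FirstOrder FirstOrder.Language

/-! ### Pure dense maps and close tuples -/

/-- An injective homomorphism whose range is a pure subgroup meeting every coset of `n • B`, for
every nonzero integer `n`. -/
structure IsPureDense {A B : Type*} [AddCommGroup A] [AddCommGroup B] (f : A →+ B) : Prop where
  injective : Function.Injective f
  exists_eq_of_zsmul_eq : ∀ (n : ℤ) (x : A) (y : B), n ≠ 0 → n • y = f x → ∃ x', f x' = y
  exists_eq_add_zsmul : ∀ (n : ℤ) (y : B), n ≠ 0 → ∃ x z, y = f x + n • z

/-- Two tuples are close if they are congruent modulo `m` and satisfy the same linear equations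
with integer coefficients of absolute value at most `r`. -/
def Close {B : Type*} [AddCommGroup B] (m : ℤ) (r : ℕ) {n : ℕ} (a b : Fin n → B) : Prop :=
  (∀ i, ∃ z, a i - b i = m • z) ∧
    ∀ c : Fin n → ℤ, (∀ i, |c i| ≤ r) → (∑ i, c i • a i = 0 ↔ ∑ i, c i • b i = 0)

namespace Close

variable {B : Type*} [AddCommGroup B] {m m' : ℤ} {r r' n : ℕ} {a b : Fin n → B}

theorem refl (m : ℤ) (r : ℕ) (a : Fin n → B) : Close m r a a :=
  ⟨fun i => ⟨0, by simp⟩, fun _ _ => Iff.rfl⟩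

theorem symm (h : Close m r a b) : Close m r b a := by
  refine ⟨fun i => ?_, fun c hc => (h.2 c hc).symm⟩
  obtain ⟨z, hz⟩ := h.1 i
  exact ⟨-z, by rw [smul_neg, ← hz, neg_sub]⟩

theorem mono (h : Close m' r' a b) (hm : m ∣ m') (hr : r ≤ r') : Close m r a b := by
  refine ⟨fun i => ?_, fun c hc => h.2 c fun i => (hc i).trans (by exact_mod_cast hr)⟩
  obtain ⟨z, hz⟩ := h.1 i
  obtain ⟨t, rfl⟩ := hm
  exact ⟨t • z, by rw [hz, mul_smul]⟩

end Close

theorem IsPureDense.id (A : Type*) [AddCommGroup A] : IsPureDense (AddMonoidHom.id A) :=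
  ⟨fun _ _ h => h, fun _ _ y _ _ => ⟨y, rfl⟩, fun _ y _ => ⟨y, 0, by simp⟩⟩

/-! ### Extending close tuples by one element -/

section Extension

variable {A B : Type*} [AddCommGroup A] [AddCommGroup B] [IsAddTorsionFree B] {f : A →+ B}

/-- Extension of close tuples by an element which depends linearly on the first tuple. -/
theorem IsPureDense.exists_close_snoc_of_relation (hf : IsPureDense f) {m : ℤ}
    {r n : ℕ} {a : Fin n → B} {b : Fin n → A}
    (hab : Close (m * r.factorial) (2 * r * r) a (f ∘ b)) {c : B} {g : Fin n → ℤ} {e : ℤ}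
    (hg : ∀ i, |g i| ≤ r) (he : |e| ≤ r) (he0 : e ≠ 0) (h : ∑ i, g i • a i + e • c = 0) :
    ∃ d : A, Close m r (Fin.snoc a c : Fin (n + 1) → B) (Fin.snoc (f ∘ b) (f d)) := by
  choose z hz using hab.1
  -- The factorial in the modulus is there to be divisible by every possible `e`, so the error can
  -- be divided by `e` and still be a multiple of `m`.
  obtain ⟨t, ht⟩ : e ∣ (r.factorial : ℤ) := by
    rw [← Int.natAbs_dvd]
    refine Int.natCast_dvd_natCast.2 (Nat.dvd_factorial (Int.natAbs_pos.2 he0) ?_)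
    zify; exact he
  have key : e • (c + (m * t) • ∑ i, g i • z i) = f (-∑ i, g i • b i) := by
    have h1 : (m * r.factorial) • ∑ i, g i • z i = ∑ i, g i • a i - ∑ i, g i • f (b i) := by
      rw [← Finset.sum_sub_distrib, Finset.smul_sum]
      refine Finset.sum_congr rfl fun i _ => ?_
      rw [← smul_sub, smul_comm, ← hz]; rfl
    rw [smul_add, ← mul_smul, show e * (m * t) = m * r.factorial by rw [ht]; ring, h1,
      map_neg, map_sum]
    simp only [map_zsmul]
    rw [← sub_eq_zero, ← h]; abel
  obtain ⟨d, hd⟩ := hf.exists_eq_of_zsmul_eq _ _ _ he0 key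
  have hrel : ∑ i, g i • f (b i) + e • f d = 0 := by
    rw [hd, key, map_neg, map_sum]; simp
  -- Eliminating `w` between two relations leaves a relation on `v` alone; its coefficients are at
  -- most `2 * r * r`, whence that bound.
  have aux : ∀ (v : Fin n → B) (w : B), ∑ i, g i • v i + e • w = 0 → ∀ (g' : Fin n → ℤ) (e' : ℤ),
      (∑ i, g' i • v i + e' • w = 0 ↔ ∑ i, (e * g' i - e' * g i) • v i = 0) := by
    intro v w hvw g' e'
    have : ∑ i, (e * g' i - e' * g i) • v i = e • (∑ i, g' i • v i + e' • w) := by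
      have h2 : ∑ i, (e * g' i - e' * g i) • v i
          = e • ∑ i, g' i • v i - e' • ∑ i, g i • v i := by
        simp only [Finset.smul_sum, ← Finset.sum_sub_distrib, sub_smul, mul_smul]
      rw [h2, eq_neg_of_add_eq_zero_left hvw, smul_add, smul_neg, sub_neg_eq_add, smul_comm e' e]
    rw [this, smul_eq_zero_iff_right he0]
  refine ⟨d, ?_, ?_⟩
  · intro i
    refine Fin.lastCases ?_ (fun i => ?_) i
    · refine ⟨-(t • ∑ i, g i • z i), ?_⟩
      simp only [Fin.snoc_last, hd, mul_smul, smul_neg]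
      abel
    · exact ⟨(r.factorial : ℤ) • z i, by simpa [mul_smul] using hz i⟩
  · intro k hk
    simp only [Fin.sum_univ_castSucc, Fin.snoc_castSucc, Fin.snoc_last]
    rw [aux a c h, aux (f ∘ b) _ hrel]
    refine hab.2 _ fun i => ?_
    have h1 := hk (Fin.last n)
    have h2 := hk i.castSucc
    have h3 := hg i
    calc |e * k i.castSucc - k (Fin.last n) * g i|
        ≤ |e| * |k i.castSucc| + |k (Fin.last n)| * |g i| := by
          rw [← abs_mul, ← abs_mul]; exact abs_sub _ _
      _ ≤ r * r + r * r := by gcongr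
      _ = ((2 * r * r : ℕ) : ℤ) := by push_cast; ring

theorem IsPureDense.infinite_of_nontrivial (hf : IsPureDense f) [Nontrivial A] : Infinite A := by
  obtain ⟨x, hx⟩ := exists_ne (0 : A)
  refine Infinite.of_injective (fun k : ℤ => k • x) fun k l hkl => ?_
  by_contra hne
  have : (k - l) • f x = 0 := by
    have := congrArg f hkl
    simp only [map_zsmul] at this
    rw [sub_smul, this, sub_self]
  rw [smul_eq_zero_iff_right (sub_ne_zero.2 hne)] at this
  exact hx (hf.injective (by simpa using this))

/-- Extension of close tuples by an element satisfying no bounded linear relation over the first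
tuple. -/
theorem IsPureDense.exists_close_snoc_of_forall_ne (hf : IsPureDense f) [Nontrivial A] {m : ℤ}
    (hm : m ≠ 0) {r n : ℕ} {a : Fin n → B} {b : Fin n → A} (hab : Close m r a (f ∘ b)) {c : B}
    (h : ∀ (g : Fin n → ℤ) (e : ℤ), (∀ i, |g i| ≤ r) → |e| ≤ r → e ≠ 0 →
      ∑ i, g i • a i + e • c ≠ 0) :
    ∃ d : A, Close m r (Fin.snoc a c : Fin (n + 1) → B) (Fin.snoc (f ∘ b) (f d)) := by
  have := hf.infinite_of_nontrivial
  obtain ⟨d₀, z₀, hd₀⟩ := hf.exists_eq_add_zsmul m c hm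
  let K : Set ((Fin n → ℤ) × ℤ) :=
    (Set.univ.pi fun _ => Set.Icc (-(r : ℤ)) r) ×ˢ Set.Icc (-(r : ℤ)) r
  have hK : K.Finite := (Set.Finite.pi' fun _ => Set.finite_Icc _ _).subset
    (by intro x hx i; exact hx i trivial) |>.prod (Set.finite_Icc _ _)
  -- Each of the finitely many bounded relations excludes at most one `y`, while `A` is infinite.
  let bad : Set A := ⋃ k ∈ K, {y | k.2 ≠ 0 ∧ ∑ i, k.1 i • f (b i) + k.2 • f (d₀ + m • y) = 0}
  have hbad : bad.Finite := by
    refine hK.biUnion fun k _ => Set.Subsingleton.finite ?_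
    rintro y ⟨hk, hy⟩ y' ⟨-, hy'⟩
    have h1 := add_left_cancel (hy.trans hy'.symm)
    have h2 := hf.injective (zsmul_right_injective hk h1)
    have h3 := congrArg f (add_left_cancel h2)
    rw [map_zsmul, map_zsmul] at h3
    exact hf.injective (zsmul_right_injective hm h3)
  obtain ⟨y, hy⟩ := hbad.exists_notMem
  refine ⟨d₀ + m • y, ?_, ?_⟩
  · intro i
    refine Fin.lastCases ?_ (fun i => ?_) i
    · refine ⟨z₀ - f y, ?_⟩
      simp only [Fin.snoc_last, map_add, map_zsmul, smul_sub]
      rw [hd₀]; abel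
    · simpa using hab.1 i
  · intro k hk
    simp only [Fin.sum_univ_castSucc, Fin.snoc_castSucc, Fin.snoc_last]
    by_cases h0 : k (Fin.last n) = 0
    · simp only [h0, zero_smul, add_zero]
      exact hab.2 _ fun i => hk _
    · refine iff_of_false (h _ _ (fun i => hk _) (hk _) h0) fun hz => hy ?_
      simp only [bad, Set.mem_iUnion]
      refine ⟨(fun i => k i.castSucc, k (Fin.last n)), ⟨?_, ?_⟩, h0, hz⟩
      · exact fun i _ => abs_le.1 (hk _)
      · exact abs_le.1 (hk _)

theorem IsPureDense.exists_close_snoc (hf : IsPureDense f) [Nontrivial A] {m : ℤ} (hm : m ≠ 0)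
    {r n : ℕ} {a : Fin n → B} {b : Fin n → A}
    (hab : Close (m * r.factorial) (2 * r * r + r) a (f ∘ b)) (c : B) :
    ∃ d : A, Close m r (Fin.snoc a c : Fin (n + 1) → B) (Fin.snoc (f ∘ b) (f d)) := by
  by_cases h : ∃ (g : Fin n → ℤ) (e : ℤ), (∀ i, |g i| ≤ r) ∧ |e| ≤ r ∧ e ≠ 0 ∧
      ∑ i, g i • a i + e • c = 0
  · obtain ⟨g, e, hg, he, he0, h⟩ := h
    exact hf.exists_close_snoc_of_relation (hab.mono dvd_rfl (by lia)) hg he he0 h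
  · push Not at h
    exact hf.exists_close_snoc_of_forall_ne hm (hab.mono (dvd_mul_right _ _) (by lia)) h

end Extension

/-! ### Closeness preserves formulas; elementarity -/

section Formulas

variable {B : Type*} [AddCommGroup B]

theorem exists_realize_term_eq_sum {n : ℕ} (t : addLanguage.Term (Empty ⊕ Fin n)) :
    letI := addStructure B
    ∃ c : Fin n → ℤ, ∀ (e : Empty → B) (v : Fin n → B),
      t.realize (Sum.elim e v) = ∑ i, c i • v i := by
  let := addStructure B
  induction t with
  | var x =>
    rcases x with x | x
    · exact x.elim
    · exact ⟨Pi.single x 1, fun e v => by simp [Pi.single_apply, ite_smul]⟩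
  | func F ts ih =>
    cases F
    choose c hc using ih
    refine ⟨c 0 + c 1, fun e v => ?_⟩
    change (ts 0).realize _ + (ts 1).realize _ = _
    rw [hc, hc, ← Finset.sum_add_distrib]
    simp [add_smul]

/-- Every formula is preserved by sufficiently close tuples. -/
theorem exists_realize_iff_of_close [IsAddTorsionFree B] [Nontrivial B] {n : ℕ}
    (φ : addLanguage.BoundedFormula Empty n) :
    letI := addStructure B
    ∃ (m : ℤ) (r : ℕ), m ≠ 0 ∧ ∀ (e : Empty → B) (a b : Fin n → B), Close m r a b →
      (φ.Realize e a ↔ φ.Realize e b) := by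
  let := addStructure B
  induction φ with
  | falsum => exact ⟨1, 0, one_ne_zero, fun _ _ _ _ => Iff.rfl⟩
  | @equal n t₁ t₂ =>
    obtain ⟨c, hc⟩ := exists_realize_term_eq_sum (B := B) t₁
    obtain ⟨d, hd⟩ := exists_realize_term_eq_sum (B := B) t₂
    refine ⟨1, ∑ i, (c i - d i).natAbs, one_ne_zero, fun e a b hab => ?_⟩
    have h := hab.2 (fun i => c i - d i) fun i => by
      rw [Int.abs_eq_natAbs]
      exact_mod_cast Finset.single_le_sum (f := fun i => (c i - d i).natAbs)
        (fun _ _ => Nat.zero_le _) (Finset.mem_univ i)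
    simp only [sub_smul, Finset.sum_sub_distrib, sub_eq_zero] at h
    change t₁.realize _ = t₂.realize _ ↔ t₁.realize _ = t₂.realize _
    rwa [hc, hc, hd, hd]
  | rel R => exact R.elim
  | imp φ ψ ih₁ ih₂ =>
    obtain ⟨m₁, r₁, h₁, H₁⟩ := ih₁
    obtain ⟨m₂, r₂, h₂, H₂⟩ := ih₂
    refine ⟨m₁ * m₂, max r₁ r₂, mul_ne_zero h₁ h₂, fun e a b hab => ?_⟩
    exact imp_congr (H₁ e a b (hab.mono (dvd_mul_right _ _) (le_max_left _ _)))
      (H₂ e a b (hab.mono (dvd_mul_left _ _) (le_max_right _ _)))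
  | all φ ih =>
    obtain ⟨m, r, hm, H⟩ := ih
    refine ⟨m * r.factorial, 2 * r * r + r,
      mul_ne_zero hm (by exact_mod_cast r.factorial_ne_zero), ?_⟩
    have key : ∀ (e : Empty → B) (a b : Fin _ → B),
        Close (m * r.factorial) (2 * r * r + r) a b → φ.all.Realize e a → φ.all.Realize e b := by
      intro e a b hab ha c
      obtain ⟨d, hd⟩ := (IsPureDense.id B).exists_close_snoc hm hab.symm c
      exact (H e _ _ hd).2 (ha d)
    exact fun e a b hab => ⟨key e a b hab, key e b a hab.symm⟩

end Formulas

/-- A pure dense embedding of a nontrivial group into a torsion-free group is elementary. -/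
theorem IsPureDense.nonempty_elementaryEmbedding {A : Type u} {B : Type v} [AddCommGroup A]
    [AddCommGroup B] [IsAddTorsionFree B] [Nontrivial A] {f : A →+ B} (hf : IsPureDense f) :
    letI := addStructure A
    letI := addStructure B
    Nonempty (A ↪ₑ[addLanguage] B) := by
  let := addStructure A
  let := addStructure B
  have : Nontrivial B := hf.injective.nontrivial
  let F : A ↪[addLanguage] B :=
    { toFun := f
      inj' := hf.injective
      map_fun' := by
        rintro n g x
        cases g
        exact map_add f (x 0) (x 1)
      map_rel' := by rintro n r; exact r.elim }
  -- Tarski–Vaught test: the extension property, applied to a tuple close to itself, moves a witness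
  -- in `B` into the range of `f`.
  refine ⟨F.toElementaryEmbedding fun n φ x a ha => ?_⟩
  obtain ⟨m, r, hm, H⟩ := exists_realize_iff_of_close (B := B) φ
  obtain ⟨d, hd⟩ := hf.exists_close_snoc hm (Close.refl _ _ (f ∘ x)) a
  exact ⟨d, (H _ _ _ hd).1 ha⟩

/-! ### Closure properties of pure dense maps -/

namespace IsPureDense

variable {A B C : Type*} [AddCommGroup A] [AddCommGroup B] [AddCommGroup C]

theorem of_bijective (f : A →+ B) (hf : Function.Bijective f) : IsPureDense f where
  injective := hf.1
  exists_eq_of_zsmul_eq _ _ y _ _ := hf.2 y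
  exists_eq_add_zsmul _ y _ := by
    obtain ⟨x, rfl⟩ := hf.2 y
    exact ⟨x, 0, by simp⟩

theorem comp {g : B →+ C} {f : A →+ B} (hg : IsPureDense g) (hf : IsPureDense f) :
    IsPureDense (g.comp f) where
  injective := hg.injective.comp hf.injective
  exists_eq_of_zsmul_eq n x y hn h := by
    obtain ⟨y, rfl⟩ := hg.exists_eq_of_zsmul_eq n _ y hn h
    rw [← map_zsmul] at h
    obtain ⟨x', rfl⟩ := hf.exists_eq_of_zsmul_eq n x y hn (hg.injective h)
    exact ⟨x', rfl⟩
  exists_eq_add_zsmul n y hn := by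
    obtain ⟨x, z, rfl⟩ := hg.exists_eq_add_zsmul n y hn
    obtain ⟨x, w, rfl⟩ := hf.exists_eq_add_zsmul n x hn
    exact ⟨x, g w + z, by simp [add_assoc]⟩

variable {ι : Type*} {α β : ι → Type*} [∀ i, AddCommGroup (α i)] [∀ i, AddCommGroup (β i)]
  {f : ∀ i, α i →+ β i}

theorem piMap (hf : ∀ i, IsPureDense (f i)) : IsPureDense (AddMonoidHom.piMap f) where
  injective := Function.Injective.piMap fun i => (hf i).injective
  exists_eq_of_zsmul_eq n x y hn h := by
    choose x' hx' using fun i => (hf i).exists_eq_of_zsmul_eq n (x i) (y i) hn (congrFun h i)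
    exact ⟨x', funext hx'⟩
  exists_eq_add_zsmul n y hn := by
    choose x z h using fun i => (hf i).exists_eq_add_zsmul n (y i) hn
    exact ⟨x, z, funext h⟩

theorem directSumMap (hf : ∀ i, IsPureDense (f i)) : IsPureDense (DirectSum.map f) where
  injective := (DirectSum.map_injective f).2 fun i => (hf i).injective
  exists_eq_of_zsmul_eq n x y hn h := by
    classical
    have h' : ∀ i, ∃ x', f i x' = y i := fun i =>
      (hf i).exists_eq_of_zsmul_eq n (x i) (y i) hn (by
        rw [← DirectSum.map_apply, ← h]; rfl)
    -- Preimages are collected over the support of `y` only, to obtain an element of the direct sum.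
    have key : ∀ s : Finset ι, ∃ x', DirectSum.map f x' = ∑ i ∈ s, DirectSum.of β i (y i) := by
      intro s
      choose x' hx' using h'
      exact ⟨∑ i ∈ s, DirectSum.of α i (x' i), by simp [hx']⟩
    obtain ⟨x', hx'⟩ := key (DFinsupp.support y)
    exact ⟨x', hx'.trans (DirectSum.sum_support_of y)⟩
  exists_eq_add_zsmul n y hn := by
    classical
    induction y using DirectSum.induction_on with
    | zero => exact ⟨0, 0, by simp⟩
    | of i y =>
      obtain ⟨x, z, rfl⟩ := (hf i).exists_eq_add_zsmul n y hn
      exact ⟨DirectSum.of α i x, DirectSum.of β i z, by simp⟩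
    | add y y' h h' =>
      obtain ⟨x, z, rfl⟩ := h
      obtain ⟨x', z', rfl⟩ := h'
      exact ⟨x + x', z + z', by rw [map_add, smul_add]; abel⟩

end IsPureDense

instance isAddTorsionFree_directSum {ι : Type*} {β : ι → Type*} [∀ i, AddCommGroup (β i)]
    [∀ i, IsAddTorsionFree (β i)] : IsAddTorsionFree (⨁ i, β i) where
  nsmul_right_injective n hn x y h := by
    ext i
    exact nsmul_right_injective hn (DFunLike.congr_fun h i)

/-! ### Groups of `p`-adic points and their homomorphisms -/

section Padic

variable {p : ℕ} [Fact p.Prime]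

/-- The additive group of `p`-adic integers lying in a rational subspace of `ℚ_[p]`. -/
def padicPoints (V : Submodule ℚ ℚ_[p]) : AddSubgroup ℤ_[p] where
  carrier := {z | (z : ℚ_[p]) ∈ V}
  add_mem' {x y} hx hy := by simpa using V.add_mem hx hy
  zero_mem' := by simp
  neg_mem' {x} hx := by simpa using hx

theorem mem_padicPoints {V : Submodule ℚ ℚ_[p]} {z : ℤ_[p]} :
    z ∈ padicPoints V ↔ (z : ℚ_[p]) ∈ V := Iff.rfl

theorem mem_of_zsmul_mem {V : Submodule ℚ ℚ_[p]} {n : ℤ} (hn : n ≠ 0) {z : ℚ_[p]}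
    (h : n • z ∈ V) : z ∈ V := by
  have := V.smul_mem ((n : ℚ)⁻¹) h
  rwa [← Int.cast_smul_eq_zsmul ℚ, smul_smul, inv_mul_cancel₀ (by exact_mod_cast hn),
    one_smul] at this

theorem intCast_mem_padicPoints {V : Submodule ℚ ℚ_[p]} (h1 : (1 : ℚ_[p]) ∈ V) (k : ℤ) :
    (k : ℤ_[p]) ∈ padicPoints V := by
  have := V.smul_mem (k : ℚ) h1
  simpa [mem_padicPoints, Algebra.smul_def] using this

theorem exists_eq_intCast_add_zsmul (z : ℤ_[p]) {n : ℤ} (hn : n ≠ 0) :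
    ∃ (k : ℤ) (t : ℤ_[p]), z = k + n • t := by
  have hn' : (n : ℤ_[p]) ≠ 0 := by exact_mod_cast hn
  obtain ⟨u, m, hu⟩ : ∃ (u : ℤ_[p]ˣ) (m : ℕ), (n : ℤ_[p]) = u * (p : ℤ_[p]) ^ m :=
    ⟨_, _, PadicInt.unitCoeff_spec hn'⟩
  obtain ⟨t, ht⟩ := Ideal.mem_span_singleton'.1 (PadicInt.appr_spec m z)
  refine ⟨(z.appr m : ℤ), ↑u⁻¹ * t, ?_⟩
  rw [zsmul_eq_mul, hu, ← sub_eq_iff_eq_add', Int.cast_natCast, ← ht, mul_mul_mul_comm,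
    Units.mul_inv, one_mul, mul_comm]

/-- Multiplication by a `p`-adic unit, as a map between groups of `p`-adic points. -/
noncomputable def padicMul (u : ℤ_[p]ˣ) {V W : Submodule ℚ ℚ_[p]}
    (h : ∀ v ∈ V, ((u : ℤ_[p]) : ℚ_[p]) * v ∈ W) : padicPoints V →+ padicPoints W where
  toFun z := ⟨u * z, by simpa [mem_padicPoints] using h _ z.2⟩
  map_zero' := by simp
  map_add' x y := by ext; simp [mul_add]

/-- Purity holds because `V` is a rational space and `u` a unit; density because the multiples `u *
k` with `k ∈ ℤ` already represent every class modulo `n`. -/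
theorem isPureDense_padicMul (u : ℤ_[p]ˣ) {V W : Submodule ℚ ℚ_[p]}
    (h : ∀ v ∈ V, ((u : ℤ_[p]) : ℚ_[p]) * v ∈ W) (h1 : (1 : ℚ_[p]) ∈ V) :
    IsPureDense (padicMul u h) where
  injective x y hxy := by
    have := congrArg Subtype.val hxy
    exact Subtype.ext (u.isUnit.mul_left_cancel this)
  exists_eq_of_zsmul_eq n x y hn hxy := by
    have h' : n • (y : ℤ_[p]) = u * x := congrArg Subtype.val hxy
    have h2 : n • (↑u⁻¹ * (y : ℤ_[p])) = x := by
      rw [← mul_smul_comm, h', Units.inv_mul_cancel_left]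
    refine ⟨⟨↑u⁻¹ * y, mem_of_zsmul_mem hn ?_⟩, Subtype.ext (Units.mul_inv_cancel_left _ _)⟩
    have h3 := x.2
    rw [← h2, mem_padicPoints] at h3
    simpa using h3
  exists_eq_add_zsmul n y hn := by
    obtain ⟨k, t, hk⟩ := exists_eq_intCast_add_zsmul ((↑u⁻¹ : ℤ_[p]) * (y : ℤ_[p])) hn
    have hy : (y : ℤ_[p]) = (u : ℤ_[p]) * (k : ℤ_[p]) + n • ((u : ℤ_[p]) * t) := by
      rw [← mul_smul_comm, ← mul_add, ← hk, Units.mul_inv_cancel_left]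
    have hk' := intCast_mem_padicPoints h1 k
    refine ⟨⟨k, hk'⟩, ⟨(u : ℤ_[p]) * t, mem_of_zsmul_mem hn ?_⟩, Subtype.ext hy⟩
    have h3 := (padicPoints W).sub_mem y.2 (padicMul u h ⟨k, hk'⟩).2
    rw [hy] at h3
    have h4 : n • ((u : ℤ_[p]) * t) ∈ padicPoints W := by simpa [padicMul] using h3
    rw [mem_padicPoints] at h4
    simpa using h4

/-- Homomorphisms from a group of `p`-adic points to `ℤ_[p]` are multiplications. -/
theorem padicPoints_hom_eq_mul {V : Submodule ℚ ℚ_[p]} (h1 : (1 : ℚ_[p]) ∈ V)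
    (f : padicPoints V →+ ℤ_[p]) (y : padicPoints V) :
    f y = y * f ⟨1, by simpa [mem_padicPoints] using h1⟩ := by
  set e : padicPoints V := ⟨1, by simpa [mem_padicPoints] using h1⟩
  rw [← sub_eq_zero]
  -- Modulo `p ^ n`, the element `y` is an integer multiple of `e`, so both sides agree modulo every
  -- power of `p`.
  refine PadicInt.ext_of_toZModPow.1 fun n => ?_
  rw [map_zero, ← RingHom.mem_ker, PadicInt.ker_toZModPow, Ideal.mem_span_singleton]
  have hpn : ((p : ℤ) ^ n) ≠ 0 := pow_ne_zero _ (by exact_mod_cast (Fact.out : p.Prime).ne_zero)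
  obtain ⟨k, t, hk⟩ := exists_eq_intCast_add_zsmul (y : ℤ_[p]) hpn
  have ht : t ∈ padicPoints V := by
    refine mem_of_zsmul_mem hpn ?_
    have h3 := (padicPoints V).sub_mem y.2 (intCast_mem_padicPoints h1 k)
    rw [hk, add_sub_cancel_left, mem_padicPoints] at h3
    simpa using h3
  have hy : y = k • e + ((p : ℤ) ^ n) • ⟨t, ht⟩ := Subtype.ext (by simpa [e] using hk)
  refine ⟨f ⟨t, ht⟩ - t * f e, ?_⟩
  have h4 : f y = k • f e + ((p : ℤ) ^ n) • f ⟨t, ht⟩ := by rw [hy]; simp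
  rw [h4, hk]
  simp only [zsmul_eq_mul]
  push_cast
  ring

/-- There are no nonzero homomorphisms from `p`-adic points to `q`-adic integers for `p ≠ q`. -/
theorem padicPoints_hom_eq_zero {q : ℕ} [Fact q.Prime] (hpq : p ≠ q) {V : Submodule ℚ ℚ_[p]}
    (f : padicPoints V →+ ℤ_[q]) (y : padicPoints V) : f y = 0 := by
  -- As `q` is a unit in `ℤ_[p]`, the source is `q`-divisible, so `f y` is divisible by every `q ^
  -- n`.
  refine PadicInt.ext_of_toZModPow.1 fun n => ?_
  rw [map_zero, ← RingHom.mem_ker, PadicInt.ker_toZModPow, Ideal.mem_span_singleton]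
  have hu : IsUnit ((q : ℤ_[p]) ^ n) := by
    refine IsUnit.pow _ (PadicInt.isUnit_iff.2 ?_)
    refine le_antisymm (PadicInt.norm_le_one _) (not_lt.1 fun h => ?_)
    have := (PadicInt.norm_int_lt_one_iff_dvd (p := p) (q : ℤ)).1 (by exact_mod_cast h)
    exact hpq ((Nat.prime_dvd_prime_iff_eq Fact.out Fact.out).1 (by exact_mod_cast this))
  obtain ⟨t, ht⟩ := hu.dvd (a := (y : ℤ_[p]))
  have hqn : ((q : ℤ) ^ n) ≠ 0 := pow_ne_zero _ (by exact_mod_cast (Fact.out : q.Prime).ne_zero)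
  have hV : t ∈ padicPoints V := by
    refine mem_of_zsmul_mem hqn ?_
    have := y.2
    rw [ht, mem_padicPoints] at this
    simpa using this
  have hy : y = ((q : ℤ) ^ n) • ⟨t, hV⟩ := Subtype.ext (by simpa using ht)
  exact ⟨f ⟨t, hV⟩, by rw [hy]; simp⟩

theorem padicInt_isUnit_intCast {k : ℤ} (hk : ¬ (p : ℤ) ∣ k) : IsUnit (k : ℤ_[p]) := by
  rw [PadicInt.isUnit_iff]
  exact le_antisymm (PadicInt.norm_le_one _)
    (not_lt.1 fun h => hk ((PadicInt.norm_int_lt_one_iff_dvd k).1 h))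

/-- The field `ℚ_[p]` is uncountable, so it has a transcendental element; inverting if necessary
makes it an integer `y`, and `1 + p * y` is a transcendental unit. -/
theorem exists_transcendental_unit (p : ℕ) [Fact p.Prime] :
    ∃ u : ℤ_[p]ˣ, Transcendental ℚ ((u : ℤ_[p]) : ℚ_[p]) := by
  obtain ⟨x, hx⟩ : ∃ x : ℚ_[p], Transcendental ℚ x := by
    by_contra! h
    have h1 := Algebraic.countable ℚ ℚ_[p]
    have h2 : {x : ℚ_[p] | IsAlgebraic ℚ x} = Set.univ :=
      Set.eq_univ_of_forall fun x => not_not.1 (h x)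
    rw [h2, ← Cardinal.le_aleph0_iff_set_countable, Cardinal.mk_univ] at h1
    exact absurd ((continuum_le_cardinal_of_nontriviallyNormedField ℚ_[p]).trans h1)
      (not_le.2 Cardinal.aleph0_lt_continuum)
  wlog hx1 : ‖x‖ ≤ 1 generalizing x
  · refine this x⁻¹ (fun h => hx (by simpa using h.inv)) ?_
    rw [norm_inv]
    exact inv_le_one_of_one_le₀ (not_le.1 hx1).le
  obtain ⟨y, rfl⟩ : ∃ y : ℤ_[p], (y : ℚ_[p]) = x := ⟨⟨x, hx1⟩, rfl⟩
  have hu : IsUnit (1 + (p : ℤ_[p]) * y) := by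
    have h := (IsLocalRing.mem_maximalIdeal ((p : ℤ_[p]) * y)).1
      (Ideal.mul_mem_right _ _ (by
        rw [PadicInt.maximalIdeal_eq_span_p]; exact Ideal.mem_span_singleton_self _))
    by_contra h'
    have := (IsLocalRing.maximalIdeal ℤ_[p]).sub_mem ((IsLocalRing.mem_maximalIdeal _).2 h')
      ((IsLocalRing.mem_maximalIdeal _).2 h)
    rw [add_sub_cancel_right, IsLocalRing.mem_maximalIdeal] at this
    exact this isUnit_one
  refine ⟨hu.unit, fun h => hx ?_⟩
  have hp0 : (p : ℚ_[p]) ≠ 0 := by exact_mod_cast (Fact.out : p.Prime).ne_zero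
  have h' : IsAlgebraic ℚ (1 + (p : ℚ_[p]) * (y : ℚ_[p])) := by simpa using h
  have h2 : (y : ℚ_[p]) = (1 + (p : ℚ_[p]) * y - 1) * (p : ℚ_[p])⁻¹ := by field_simp; ring
  rw [h2]
  exact (h'.sub isAlgebraic_one).mul (isAlgebraic_natCast p).inv

end Padic

open Polynomial

instance fact_prime_coe (q : Nat.Primes) : Fact (q : ℕ).Prime := ⟨q.2⟩

/-! ### `ℤ_(q)` as the rational `q`-adic integers -/

section Localization

variable (q : Nat.Primes)

theorem mem_primeCompl_iff {k : ℤ} :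
    k ∈ (Ideal.span {((q : ℕ) : ℤ)}).primeCompl ↔ ¬ ((q : ℕ) : ℤ) ∣ k := by
  rw [Ideal.mem_primeCompl_iff, Ideal.mem_span_singleton]

/-- The canonical ring homomorphism from `ℤ_(q)` to the `q`-adic integers. -/
noncomputable def zLocalToPadicInt : ZLocal q →+* ℤ_[q] :=
  IsLocalization.lift (M := (Ideal.span {((q : ℕ) : ℤ)}).primeCompl)
    (g := Int.castRingHom ℤ_[q]) fun y =>
      padicInt_isUnit_intCast ((mem_primeCompl_iff q).1 y.2)

theorem zLocalToPadicInt_mk'_mul (a : ℤ) (s : (Ideal.span {((q : ℕ) : ℤ)}).primeCompl) :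
    zLocalToPadicInt q (IsLocalization.mk' _ a s) * ((s : ℤ) : ℤ_[q]) = a := by
  have h := congrArg (zLocalToPadicInt q) (IsLocalization.mk'_spec (ZLocal q) a s)
  rwa [map_mul, zLocalToPadicInt, IsLocalization.lift_eq, IsLocalization.lift_eq] at h

theorem zLocalToPadicInt_mem (z : ZLocal q) :
    zLocalToPadicInt q z ∈ padicPoints (Submodule.span ℚ {(1 : ℚ_[q])}) := by
  obtain ⟨a, s, rfl⟩ := IsLocalization.exists_mk'_eq (Ideal.span {((q : ℕ) : ℤ)}).primeCompl z
  have hs : (s : ℤ) ≠ 0 := fun h => (mem_primeCompl_iff q).1 s.2 (h ▸ dvd_zero _)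
  refine mem_padicPoints.2 (mem_of_zsmul_mem hs ?_)
  have h := intCast_mem_padicPoints (Submodule.mem_span_singleton_self (1 : ℚ_[q])) a
  rw [← zLocalToPadicInt_mk'_mul q a s, mul_comm, mem_padicPoints] at h
  simpa using h

/-- The canonical map from `ℤ_(q)` to the rational `q`-adic integers. -/
noncomputable def zLocalToPadicPoints :
    ZLocal q →+ padicPoints (Submodule.span ℚ {(1 : ℚ_[q])}) :=
  (zLocalToPadicInt q).toAddMonoidHom.codRestrict _ (zLocalToPadicInt_mem q)

theorem zLocalToPadicPoints_bijective : Function.Bijective (zLocalToPadicPoints q) := by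
  constructor
  · rw [injective_iff_map_eq_zero]
    intro z hz
    replace hz : zLocalToPadicInt q z = 0 := congrArg Subtype.val hz
    obtain ⟨a, s, rfl⟩ := IsLocalization.exists_mk'_eq (Ideal.span {((q : ℕ) : ℤ)}).primeCompl z
    have h := zLocalToPadicInt_mk'_mul q a s
    rw [hz, zero_mul] at h
    rw [show a = 0 by exact_mod_cast h.symm, IsLocalization.mk'_zero]
  · rintro ⟨y, hy⟩
    obtain ⟨r, hr⟩ := Submodule.mem_span_singleton.1 hy
    rw [Algebra.smul_def, mul_one, eq_ratCast] at hr
    have hden := PadicInt.isUnit_den r (by rw [hr]; exact y.2)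
    have hs : (r.den : ℤ) ∈ (Ideal.span {((q : ℕ) : ℤ)}).primeCompl := by
      rw [mem_primeCompl_iff, ← PadicInt.norm_int_lt_one_iff_dvd, not_lt]
      exact (PadicInt.isUnit_iff.1 (by exact_mod_cast hden)).ge
    refine ⟨IsLocalization.mk' _ r.num ⟨_, hs⟩, Subtype.ext ?_⟩
    refine hden.mul_right_cancel ?_
    have h1 := zLocalToPadicInt_mk'_mul q r.num ⟨_, hs⟩
    rw [Int.cast_natCast] at h1
    refine h1.trans (PadicInt.ext ?_)
    have h2 : (y : ℚ_[q]) * (r.den : ℚ_[q]) = r.num := by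
      rw [← hr]; exact_mod_cast Rat.mul_den_eq_num r
    simpa using h2.symm

end Localization

/-! ### Direct sums of groups of points, and rigidity of their maps -/

section PadicSum

variable {I : Type u} {p : I → Nat.Primes} {k : I → ℕ}

/-- The direct sum of a family of groups of `p i`-adic points. -/
abbrev PadicSum (V : ∀ i, Fin (k i) → Submodule ℚ ℚ_[p i]) : Type u :=
  ⨁ i, ∀ j, padicPoints (V i j)

variable {V V' : ∀ i, Fin (k i) → Submodule ℚ ℚ_[p i]}

theorem exists_isPureDense_padicSum (h1 : ∀ i j, 1 ∈ V i j)
    (h : ∀ i j, ∃ u : ℤ_[p i]ˣ, ∀ v ∈ V i j, ((u : ℤ_[p i]) : ℚ_[p i]) * v ∈ V' i j) :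
    ∃ f : PadicSum V →+ PadicSum V', IsPureDense f := by
  choose u hu using h
  exact ⟨_, IsPureDense.directSumMap fun i => IsPureDense.piMap fun j =>
    isPureDense_padicMul (u i j) (hu i j) (h1 i j)⟩

theorem exists_isPureDense_of_zLocal (h1 : ∀ i j, 1 ∈ V i j) :
    ∃ f : (⨁ i, (Fin (k i) → ZLocal (p i))) →+ PadicSum V, IsPureDense f :=
  ⟨_, IsPureDense.directSumMap fun i => IsPureDense.piMap fun j =>
    (isPureDense_padicMul 1 (V := Submodule.span ℚ {1}) (W := V i j)
      (fun v hv => by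
        simpa using (Submodule.span_singleton_le_iff_mem 1 (V i j)).2 (h1 i j) hv)
      (Submodule.mem_span_singleton_self _)).comp
      (IsPureDense.of_bijective _ (zLocalToPadicPoints_bijective (p i)))⟩

open scoped Classical in
/-- The inclusion of a component. -/
noncomputable def PadicSum.incl (V : ∀ i, Fin (k i) → Submodule ℚ ℚ_[p i]) (i : I)
    (j : Fin (k i)) : padicPoints (V i j) →+ PadicSum V :=
  (DirectSum.of (fun i => ∀ j, padicPoints (V i j)) i).comp
    (AddMonoidHom.single (fun j => padicPoints (V i j)) j)

/-- The projection to a component, as a `p`-adic integer. -/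
noncomputable def PadicSum.proj (V : ∀ i, Fin (k i) → Submodule ℚ ℚ_[p i]) (i : I) (j : Fin (k i)) :
    PadicSum V →+ ℤ_[p i] where
  toFun x := x i j
  map_zero' := rfl
  map_add' _ _ := rfl

theorem PadicSum.proj_mem (i : I) (j : Fin (k i)) (x : PadicSum V) :
    PadicSum.proj V i j x ∈ padicPoints (V i j) := (x i j).2

theorem PadicSum.proj_incl_same (i : I) (j : Fin (k i)) (x : padicPoints (V i j)) :
    PadicSum.proj V i j (PadicSum.incl V i j x) = x := by
  classical
  change ((DirectSum.of (fun i => ∀ j, padicPoints (V i j)) i (Pi.single j x) i j :) : ℤ_[p i]) = x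
  rw [DirectSum.of_eq_same, Pi.single_eq_same]

/-- An element of a direct sum supported at one component. -/
theorem PadicSum.eq_incl {i : I} {j : Fin (k i)} {x : PadicSum V}
    (h1 : ∀ j', j' ≠ j → PadicSum.proj V i j' x = 0)
    (h2 : ∀ i', i' ≠ i → ∀ j', PadicSum.proj V i' j' x = 0) :
    x = PadicSum.incl V i j (x i j) := by
  classical
  refine DirectSum.ext fun i' => funext fun j' => Subtype.ext ?_
  by_cases hi : i' = i
  · subst hi
    by_cases hj : j' = j
    · subst hj
      exact (PadicSum.proj_incl_same i' j' (x i' j')).symm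
    · refine (h1 j' hj).trans ?_
      change 0 = ((DirectSum.of (fun i => ∀ j, padicPoints (V i j)) i' (Pi.single j (x i' j)) i' j' :) :
        ℤ_[p i'])
      rw [DirectSum.of_eq_same, Pi.single_eq_of_ne hj]
      rfl
  · refine (h2 i' hi j').trans ?_
    rw [incl, AddMonoidHom.comp_apply, DirectSum.of_eq_of_ne _ _ _ hi]
    rfl

/-- A homomorphism between sums of groups of points maps the component at `(i, j)` to the component
at `(i, j)` by a multiplication, provided that some `α` in the former multiplies no nonzero element
of another component at `i` into that component. -/
theorem PadicSum.exists_map_incl (hp : Function.Injective p) (f : PadicSum V →+ PadicSum V')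
    {i : I} {j : Fin (k i)} (h1 : 1 ∈ V i j) {α : ℤ_[p i]} (hα : α ∈ padicPoints (V i j))
    (h : ∀ j', j' ≠ j → ∀ c ∈ padicPoints (V' i j'), α * c ∈ padicPoints (V' i j') → c = 0) :
    ∃ a : ℤ_[p i], ∀ y : padicPoints (V i j), ∃ z : padicPoints (V' i j),
      (z : ℤ_[p i]) = y * a ∧ f (PadicSum.incl V i j y) = PadicSum.incl V' i j z := by
  let g (i' : I) (j' : Fin (k i')) : padicPoints (V i j) →+ ℤ_[p i'] :=
    (PadicSum.proj V' i' j').comp (f.comp (PadicSum.incl V i j))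
  refine ⟨_, fun y => ⟨_, padicPoints_hom_eq_mul h1 (g i j) y, PadicSum.eq_incl ?_ ?_⟩⟩
  · intro j' hj
    change g i j' y = 0
    have h2 := padicPoints_hom_eq_mul h1 (g i j')
    have h3 : ∀ z, g i j' z ∈ padicPoints (V' i j') := fun z => PadicSum.proj_mem _ _ _
    -- The component at `j'` is multiplication by its value `c` at `1`; both `c` and `α * c` lie in
    -- the target, which forces `c = 0`.
    have h4 := h3 ⟨α, hα⟩
    rw [h2] at h4
    exact (h2 y).trans (by rw [h j' hj _ (h3 _) h4, mul_zero])
  · intro i' hi j'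
    refine padicPoints_hom_eq_zero (fun h3 => hi ?_) (g i' j') y
    exact (hp (Nat.Primes.coe_nat_injective h3)).symm

theorem PadicSum.exists_mul_eq_one_of_addEquiv (hp : Function.Injective p)
    (f : PadicSum V ≃+ PadicSum V') {i : I} {j : Fin (k i)} (h1 : 1 ∈ V i j) (h1' : 1 ∈ V' i j)
    {α α' : ℤ_[p i]} (hα : α ∈ padicPoints (V i j)) (hα' : α' ∈ padicPoints (V' i j))
    (h : ∀ j', j' ≠ j → ∀ c ∈ padicPoints (V' i j'), α * c ∈ padicPoints (V' i j') → c = 0)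
    (h' : ∀ j', j' ≠ j → ∀ c ∈ padicPoints (V i j'), α' * c ∈ padicPoints (V i j') → c = 0) :
    ∃ a ∈ padicPoints (V' i j), ∃ b ∈ padicPoints (V i j), a * b = 1 ∧
      ∀ y ∈ padicPoints (V i j), y * a ∈ padicPoints (V' i j) := by
  obtain ⟨a, ha⟩ := PadicSum.exists_map_incl hp f.toAddMonoidHom h1 hα h
  obtain ⟨b, hb⟩ := PadicSum.exists_map_incl hp f.symm.toAddMonoidHom h1' hα' h'
  have hone : (1 : ℤ_[p i]) ∈ padicPoints (V i j) := by simpa [mem_padicPoints] using h1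
  have hone' : (1 : ℤ_[p i]) ∈ padicPoints (V' i j) := by simpa [mem_padicPoints] using h1'
  have ha' : ∀ y ∈ padicPoints (V i j), y * a ∈ padicPoints (V' i j) := fun y hy => by
    obtain ⟨z, hz, -⟩ := ha ⟨y, hy⟩
    exact hz ▸ z.2
  obtain ⟨z, hz, hfz⟩ := ha ⟨1, hone⟩
  obtain ⟨w, hw, hfw⟩ := hb z
  refine ⟨a, by simpa using ha' 1 hone, b, ?_, ?_, ha'⟩
  · obtain ⟨b', hb', -⟩ := hb ⟨1, hone'⟩
    rw [one_mul] at hb'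
    exact hb' ▸ b'.2
  · rw [← hfz] at hfw
    have h3 : PadicSum.incl V i j ⟨1, hone⟩ = PadicSum.incl V i j w := by
      rw [← hfw]; exact (f.symm_apply_apply _).symm
    have h4 := congrArg (PadicSum.proj V i j) h3
    rw [PadicSum.proj_incl_same, PadicSum.proj_incl_same, hw, hz] at h4
    simpa using h4.symm

end PadicSum

/-! ### The two rational subspaces attached to `x` -/

section Subspaces

variable {q : ℕ} [Fact q.Prime]

/-- The rational subspace of polynomial expressions in `x` without linear term. -/
noncomputable def noLinearTerm (x : ℚ_[q]) : Submodule ℚ ℚ_[q] :=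
  (LinearMap.ker (Polynomial.lcoeff ℚ 1)).map (aeval x).toLinearMap

/-- The rational subspace of polynomial expressions in `x`. -/
noncomputable def polynomialSpan (x : ℚ_[q]) : Submodule ℚ ℚ_[q] :=
  LinearMap.range (aeval x).toLinearMap

theorem mem_noLinearTerm {x z : ℚ_[q]} :
    z ∈ noLinearTerm x ↔ ∃ P : ℚ[X], P.coeff 1 = 0 ∧ aeval x P = z := Iff.rfl

theorem mem_polynomialSpan {x z : ℚ_[q]} :
    z ∈ polynomialSpan x ↔ ∃ P : ℚ[X], aeval x P = z := Iff.rfl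

theorem noLinearTerm_le_polynomialSpan (x : ℚ_[q]) : noLinearTerm x ≤ polynomialSpan x := by
  rintro z ⟨P, -, rfl⟩
  exact ⟨P, rfl⟩

theorem one_mem_noLinearTerm (x : ℚ_[q]) : 1 ∈ noLinearTerm x :=
  mem_noLinearTerm.2 ⟨1, by simp [Polynomial.coeff_one], by simp⟩

theorem sq_mul_mem_noLinearTerm {x z : ℚ_[q]} (hz : z ∈ polynomialSpan x) :
    x ^ 2 * z ∈ noLinearTerm x := by
  obtain ⟨P, rfl⟩ := hz
  refine mem_noLinearTerm.2 ⟨X ^ 2 * P, ?_, by simp⟩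
  rw [Polynomial.coeff_X_pow_mul']
  simp

/-- By transcendence this is a statement about polynomials: the linear coefficient of `X * P` is
`P(0)`, which is nonzero when `P * Q = 1`. -/
theorem not_forall_mul_mem_noLinearTerm {x a b : ℚ_[q]} (hx : Transcendental ℚ x)
    (ha : a ∈ noLinearTerm x) (hb : b ∈ polynomialSpan x) (hab : a * b = 1) :
    x * a ∉ noLinearTerm x := by
  rw [mem_noLinearTerm]
  rintro ⟨R, hR, hRx⟩
  obtain ⟨P, -, rfl⟩ := mem_noLinearTerm.1 ha
  obtain ⟨Q, rfl⟩ := mem_polynomialSpan.1 hb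
  have hinj := transcendental_iff_injective.1 hx
  have h1 : P * Q = 1 := hinj (by simpa using hab)
  have h2 : R = X * P := hinj (by simpa using hRx)
  rw [h2, Polynomial.coeff_X_mul] at hR
  have h3 := congrArg (fun S : ℚ[X] => S.coeff 0) h1
  simp [hR] at h3

theorem eq_zero_of_mul_mem_span_one {x c : ℚ_[q]} (hx : Transcendental ℚ x)
    (hc : c ∈ Submodule.span ℚ {(1 : ℚ_[q])}) (h : x * c ∈ Submodule.span ℚ {(1 : ℚ_[q])}) :
    c = 0 := by
  obtain ⟨r, rfl⟩ := Submodule.mem_span_singleton.1 hc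
  obtain ⟨s, hs⟩ := Submodule.mem_span_singleton.1 h
  by_contra hr
  refine hx ?_
  have : x = (s • (1 : ℚ_[q])) * (r • (1 : ℚ_[q]))⁻¹ := by rw [hs, mul_inv_cancel_right₀ hr]
  rw [this]
  exact (isAlgebraic_one.smul s).mul (isAlgebraic_one.smul r).inv

end Subspaces

instance isAddTorsionFree_ulift {B : Type v} [AddCommGroup B] [IsAddTorsionFree B] :
    IsAddTorsionFree (ULift.{w} B) where
  nsmul_right_injective _ hn _ _ h :=
    ULift.down_injective (nsmul_right_injective hn (congrArg ULift.down h))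

instance nontrivial_directSum_zLocal {I : Type u} [Nonempty I] {p : I → Nat.Primes} {k : I → ℕ}
    [∀ i, NeZero (k i)] : Nontrivial (⨁ i : I, (Fin (k i) → ZLocal (p i))) := by
  classical
  obtain ⟨i⟩ := ‹Nonempty I›
  exact (DirectSum.of_injective (β := fun i => Fin (k i) → ZLocal (p i)) i).nontrivial

/-! ### The two models and the failure of Schröder–Bernstein -/

section Models

variable {I : Type u} {p : I → Nat.Primes} {k : I → ℕ}

open scoped Classical in
/-- The family of subspaces which is `ℚ` everywhere except for `W` at one place. -/
noncomputable def spaceAt (i₀ : I) (j₀ : Fin (k i₀)) (W : Submodule ℚ ℚ_[p i₀]) :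
    ∀ i, Fin (k i) → Submodule ℚ ℚ_[p i] :=
  Function.update (fun _ _ => Submodule.span ℚ {1}) i₀
    (Function.update (fun _ => Submodule.span ℚ {1}) j₀ W)

variable {i₀ : I} {j₀ : Fin (k i₀)} {W W' : Submodule ℚ ℚ_[p i₀]}

theorem spaceAt_same : spaceAt (p := p) i₀ j₀ W i₀ j₀ = W := by simp [spaceAt]

theorem spaceAt_of_ne {j : Fin (k i₀)} (hj : j ≠ j₀) :
    spaceAt (p := p) i₀ j₀ W i₀ j = Submodule.span ℚ {1} := by simp [spaceAt, hj]

theorem spaceAt_of_ne_left {i : I} (hi : i ≠ i₀) (j : Fin (k i)) :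
    spaceAt (p := p) i₀ j₀ W i j = Submodule.span ℚ {1} := by simp [spaceAt, hi]

theorem one_mem_spaceAt (h1 : 1 ∈ W) (i : I) (j : Fin (k i)) : 1 ∈ spaceAt i₀ j₀ W i j := by
  by_cases hi : i = i₀
  · subst hi
    by_cases hj : j = j₀
    · subst hj; rwa [spaceAt_same]
    · rw [spaceAt_of_ne hj]; exact Submodule.mem_span_singleton_self _
  · rw [spaceAt_of_ne_left hi]; exact Submodule.mem_span_singleton_self _

theorem exists_isPureDense_spaceAt (h1 : 1 ∈ W) (u : ℤ_[p i₀]ˣ)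
    (hu : ∀ v ∈ W, ((u : ℤ_[p i₀]) : ℚ_[p i₀]) * v ∈ W') :
    ∃ f : PadicSum (spaceAt i₀ j₀ W) →+ PadicSum (spaceAt i₀ j₀ W'), IsPureDense f := by
  refine exists_isPureDense_padicSum (one_mem_spaceAt h1) fun i j => ?_
  by_cases hi : i = i₀
  · subst hi
    by_cases hj : j = j₀
    · subst hj; rw [spaceAt_same, spaceAt_same]; exact ⟨u, hu⟩
    · rw [spaceAt_of_ne hj, spaceAt_of_ne hj]; exact ⟨1, by simp⟩
  · rw [spaceAt_of_ne_left hi, spaceAt_of_ne_left hi]; exact ⟨1, by simp⟩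

theorem isEmpty_addEquiv_spaceAt (hp : Function.Injective p) {x : ℤ_[p i₀]}
    (hx : Transcendental ℚ (x : ℚ_[p i₀])) :
    IsEmpty (PadicSum (spaceAt i₀ j₀ (polynomialSpan (x : ℚ_[p i₀]))) ≃+
      PadicSum (spaceAt i₀ j₀ (noLinearTerm (x : ℚ_[p i₀])))) := by
  refine ⟨fun f => ?_⟩
  have h1 := one_mem_noLinearTerm (x : ℚ_[p i₀])
  have h0 := noLinearTerm_le_polynomialSpan _ h1
  have hx0 : (x : ℚ_[p i₀]) ∈ polynomialSpan (x : ℚ_[p i₀]) :=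
    mem_polynomialSpan.2 ⟨X, by simp⟩
  have hx1 := sq_mul_mem_noLinearTerm h0
  rw [mul_one, ← PadicInt.coe_pow] at hx1
  -- The elements `x` and `x ^ 2` separate the modified summand from the copies of `ℤ_(p)` at the
  -- same prime; the square is used on the side where `x` itself is missing.
  obtain ⟨a, ha, b, hb, hab, h⟩ := PadicSum.exists_mul_eq_one_of_addEquiv hp f (i := i₀) (j := j₀)
    (one_mem_spaceAt h0 _ _) (one_mem_spaceAt h1 _ _) (α := x) (α' := x ^ 2)
    (by rwa [spaceAt_same]) (by rwa [spaceAt_same])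
    (fun j' hj c hc hxc => by
      rw [spaceAt_of_ne hj, mem_padicPoints] at hc hxc
      rw [PadicInt.coe_mul] at hxc
      exact PadicInt.coe_eq_zero.1 <| eq_zero_of_mul_mem_span_one hx hc hxc)
    (fun j' hj c hc hxc => by
      rw [spaceAt_of_ne hj, mem_padicPoints] at hc hxc
      rw [PadicInt.coe_mul, PadicInt.coe_pow] at hxc
      exact PadicInt.coe_eq_zero.1 <| eq_zero_of_mul_mem_span_one (hx.pow two_pos) hc hxc)
  simp only [spaceAt_same] at ha hb h
  have h2 := h x hx0
  rw [mem_padicPoints, PadicInt.coe_mul] at h2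
  exact not_forall_mul_mem_noLinearTerm hx ha hb
    (by rw [← PadicInt.coe_mul, hab, PadicInt.coe_one]) h2

theorem model_Th_of_isPureDense {G : Type u} {M : Type v} [AddCommGroup G] [AddCommGroup M]
    [Nontrivial G] [IsAddTorsionFree M] {f : G →+ M} (hf : IsPureDense f) :
    letI := addStructure M
    M ⊨ Th G := by
  let := addStructure G
  let := addStructure M
  obtain ⟨F⟩ := hf.nonempty_elementaryEmbedding
  exact (F.theory_model_iff _).1 (inferInstanceAs (G ⊨ addLanguage.completeTheory G))

/-- Two torsion-free groups which embed purely and densely into each other, and into which `G` does,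
witness the failure of the Schröder–Bernstein property unless they are isomorphic. -/
theorem not_hasSBProperty_Th {G : Type u} {M N : Type w} [AddCommGroup G] [AddCommGroup M]
    [AddCommGroup N] [Nontrivial G] [IsAddTorsionFree M] [IsAddTorsionFree N]
    {f : G →+ M} (hf : IsPureDense f) {g : M →+ N} (hg : IsPureDense g)
    {h : N →+ M} (hh : IsPureDense h) (hMN : IsEmpty (M ≃+ N)) :
    ¬ Theory.HasSBProperty.{0, 0, w} (Th G) := by
  intro hSB
  let := addStructure M
  let := addStructure N
  have hM : M ⊨ Th G := model_Th_of_isPureDense hf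
  have hN : N ⊨ Th G := model_Th_of_isPureDense (hg.comp hf)
  have : Nontrivial M := hf.injective.nontrivial
  have : Nontrivial N := hg.injective.nontrivial
  obtain ⟨e⟩ := hSB (Theory.ModelType.of (Th G) M) (Theory.ModelType.of (Th G) N)
    hg.nonempty_elementaryEmbedding hh.nonempty_elementaryEmbedding
  refine hMN.false { e.toEquiv with map_add' := fun x y => ?_ }
  exact e.map_fun AddFunc.add ![x, y]

end Models

end AdditiveTheory

open AdditiveTheory in
theorem mainTheorem6 {I : Type u} [Nonempty I] (p : I → Nat.Primes)
    (hp : Function.Injective p) (k : I → ℕ) (hk : ∀ i, 0 < k i) :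
    ¬ FirstOrder.Language.Theory.HasSBProperty.{0, 0, w}
      (AdditiveTheory.Th (⨁ i : I, (Fin (k i) → AdditiveTheory.ZLocal (p i)))) := by
  obtain ⟨i₀⟩ := ‹Nonempty I›
  -- Reindexing by a set of primes puts the sums in `Type`, from where `ULift` carries them to `Type
  -- w`, whatever the universe of `I`.
  let e : I ≃ Set.range p := Equiv.ofInjective p hp
  have hp' : Function.Injective (p ∘ e.symm) := hp.comp e.symm.injective
  let j₀ : Fin (k (e.symm (e i₀))) := ⟨0, hk _⟩
  obtain ⟨x, hx⟩ := exists_transcendental_unit ((p ∘ e.symm) (e i₀))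
  have h1 := one_mem_noLinearTerm ((x : ℤ_[(p ∘ e.symm) (e i₀)]) : ℚ_[(p ∘ e.symm) (e i₀)])
  have h0 := noLinearTerm_le_polynomialSpan _ h1
  obtain ⟨f, hf⟩ := exists_isPureDense_of_zLocal (one_mem_spaceAt (j₀ := j₀)
    (k := k ∘ e.symm) h0)
  obtain ⟨g, hg⟩ := exists_isPureDense_spaceAt (j₀ := j₀) (k := k ∘ e.symm) h0 (x ^ 2)
    (fun v hv => by simpa using sq_mul_mem_noLinearTerm hv)
  obtain ⟨h, hh⟩ := exists_isPureDense_spaceAt (j₀ := j₀) (k := k ∘ e.symm) h1 1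
    (fun v hv => by simpa using noLinearTerm_le_polynomialSpan _ hv)
  have hMN := isEmpty_addEquiv_spaceAt (j₀ := j₀) (k := k ∘ e.symm) hp' hx
  have : ∀ i, NeZero (k i) := fun i => ⟨(hk i).ne'⟩
  have : Nonempty I := ⟨i₀⟩
  have up {A : Type} [AddCommGroup A] :
      IsPureDense (AddEquiv.ulift.{0, w} (α := A)).symm.toAddMonoidHom :=
    IsPureDense.of_bijective _ AddEquiv.ulift.symm.bijective
  have down {A : Type} [AddCommGroup A] :
      IsPureDense (AddEquiv.ulift.{0, w} (α := A)).toAddMonoidHom :=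
    IsPureDense.of_bijective _ AddEquiv.ulift.bijective
  have hr := IsPureDense.of_bijective
    (DirectSum.equivCongrLeft (β := fun i => Fin (k i) → ZLocal (p i)) e).toAddMonoidHom
    (AddEquiv.bijective _)
  exact not_hasSBProperty_Th (up.comp (hf.comp hr)) (up.comp (hg.comp down))
    (up.comp (hh.comp down))
    ⟨fun F => hMN.false ((AddEquiv.ulift.symm.trans F).trans AddEquiv.ulift)⟩
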